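/- Let $G=(V,E)$ be a finite tree (a finite connected simple graph without cycles), and let $D=V\cup E$ be the set of its elements. Two elements of $D$ are adjacent if they are two adjacent vertices, or two distinct edges sharing an end vertex, or an edge and one of its end vertices. A total matching is a subset $T\subseteq D$ whose elements are pairwise non-adjacent; its characteristic vector $\chi[T]\in\mathbb{R}^{V}\times\mathbb{R}^{E}$ has entry $1$ at the elements of $T$ and $0$ elsewhere. The total matching polytope of $G$ is $$P_T(G)=\operatorname{conv}\{\chi[T] : T\subseteq D \text{ is a total matching}\}.$$ Then $P_T(G)$ is equal to the set of all $(x,y)\in\mathbb{R}^{V}\times\mathbb{R}^{E}$ such that $$x_v+\sum_{e\in\delta(v)}y_e\le 1\quad\text{for all } v\in V,$$ $$x_v+x_w+y_e\le 1\quad\text{for all } e=\{v,w\}\in E,$$ $$x_v\ge 0,\; y_e\ge 0\quad\text{for all } v\in V,\ e\in E,$$ where $\delta(v)$ denotes the set of edges incident to $v$. -/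

import Mathlib

namespace TotalMatching

variable {V : Type*}

/-- The elements `D = V ∪ E` of a graph: its vertices and its edges. -/
abbrev Elt (G : SimpleGraph V) : Type _ := V ⊕ G.edgeSet

/-- Adjacency of elements: two adjacent vertices, two distinct edges with a common end vertex,
or an edge and one of its end vertices. -/
def EltAdj (G : SimpleGraph V) : Elt G → Elt G → Prop
  | Sum.inl v, Sum.inl w => G.Adj v w
  | Sum.inl v, Sum.inr e => v ∈ (e : Sym2 V)
  | Sum.inr e, Sum.inl v => v ∈ (e : Sym2 V)
  | Sum.inr e, Sum.inr f => e ≠ f ∧ ∃ v : V, v ∈ (e : Sym2 V) ∧ v ∈ (f : Sym2 V)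

/-- A total matching is a set of pairwise independent (non-adjacent) elements. -/
def IsTotalMatching (G : SimpleGraph V) (T : Set (Elt G)) : Prop :=
  T.Pairwise fun a b => ¬ EltAdj G a b

/-- The characteristic vector of a set of elements, in `ℝ^(V ∪ E)`. -/
noncomputable def charVec (G : SimpleGraph V) (T : Set (Elt G)) : Elt G → ℝ :=
  T.indicator fun _ => 1

/-- The total matching polytope: the convex hull of the characteristic vectors of the
total matchings. -/
def totalMatchingPolytope (G : SimpleGraph V) : Set (Elt G → ℝ) :=
  convexHull ℝ {z | ∃ T : Set (Elt G), IsTotalMatching G T ∧ z = charVec G T}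

end TotalMatching

/-! Total matchings are the independent sets of the total graph, and for a tree that graph is
chordal: ordering elements by distance from a root, the earlier neighbours of each element form a
clique with it, inside a vertex star or an edge triangle (`exists_clique_of_rootRank`). For such an
order the clique inequalities suffice: adding elements one by one, each new coordinate fits in the
slack of its clique (`add_slack_mem_independentSetHull`, `mem_independentSetHull_of_rank`).
Conversely, an independent set meets a clique at most once. -/

/-- The convex hull of the indicator vectors of the `r`-independent subsets of `S`. -/
def independentSetHull {D : Type*} (r : D → D → Prop) (S : Set D) : Set (D → ℝ) :=
  convexHull ℝ {z | ∃ T ⊆ S, T.Pairwise (fun a b => ¬ r a b) ∧ z = T.indicator fun _ => 1}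

theorem independentSetHull_mono {D : Type*} (r : D → D → Prop) {S S' : Set D} (h : S ⊆ S') :
    independentSetHull r S ⊆ independentSetHull r S' :=
  convexHull_mono fun _ ⟨T, hT, h1, h2⟩ => ⟨T, hT.trans h, h1, h2⟩

/-- If the neighbours of `d` in `S` lie in a clique `K`, then a point of the hull over `S` can be
raised in the coordinate `d` by its slack on `K`, staying in the hull over `insert d S`. -/
theorem add_slack_mem_independentSetHull {D : Type*} [DecidableEq D] {r : D → D → Prop}
    (hr : Std.Symm r) {S : Set D} {d : D} (hd : d ∉ S) {K : Finset D}
    (hK : ∀ a ∈ K, ∀ b ∈ K, a ≠ b → r a b) (hN : ∀ x ∈ S, r x d → x ∈ K)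
    {g : D → ℝ} (hg : g ∈ independentSetHull r S) :
    g + (1 - ∑ k ∈ K, g k) • Pi.single d (1 : ℝ) ∈ independentSetHull r (insert d S) := by
  -- The map is affine, so indicator vectors suffice; there the slack is 0 or 1, and 1 means that
  -- `d` may join the set.
  let F : (D → ℝ) →ᵃ[ℝ] (D → ℝ) :=
    { toFun := fun g => g + (1 - ∑ k ∈ K, g k) • Pi.single d (1 : ℝ)
      linear := LinearMap.id - (∑ k ∈ K, LinearMap.proj k).smulRight (Pi.single d (1 : ℝ))
      map_vadd' := by
        intro p v
        ext i
        simp [Finset.sum_add_distrib]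
        ring }
  have hF : ∀ g, F g = g + (1 - ∑ k ∈ K, g k) • Pi.single d (1 : ℝ) := fun _ => rfl
  have key : independentSetHull r S ⊆ F ⁻¹' independentSetHull r (insert d S) := by
    refine convexHull_min ?_ ((convex_convexHull ℝ _).affine_preimage F)
    rintro _ ⟨T, hTS, hT, rfl⟩
    refine subset_convexHull ℝ _ ?_
    have hdT : d ∉ T := fun h => hd (hTS h)
    by_cases hTK : ∃ k ∈ K, k ∈ T
    · obtain ⟨k, hk, hkT⟩ := hTK
      have hsum : ∑ x ∈ K, T.indicator (fun _ => (1 : ℝ)) x = 1 := by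
        rw [Finset.sum_eq_single_of_mem k hk, Set.indicator_of_mem hkT]
        intro b hb hbk
        exact Set.indicator_of_notMem (fun hbT => hT hbT hkT hbk (hK b hb k hk hbk)) _
      refine ⟨T, hTS.trans (Set.subset_insert _ _), hT, ?_⟩
      rw [hF, hsum]
      simp
    · push Not at hTK
      have hsum : ∑ x ∈ K, T.indicator (fun _ => (1 : ℝ)) x = 0 :=
        Finset.sum_eq_zero fun k hk => Set.indicator_of_notMem (hTK k hk) _
      refine ⟨insert d T, Set.insert_subset_insert hTS, ?_, ?_⟩
      · refine hT.insert fun b hb _ => ?_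
        have : ¬ r b d := fun h => hTK b (hN b (hTS hb) h) hb
        exact ⟨fun h => this (hr.symm _ _ h), this⟩
      · rw [hF, hsum]
        ext i
        by_cases hi : i = d
        · subst hi
          simp [hdT]
        · by_cases hiT : i ∈ T <;> simp [Set.indicator, hi, hiT]
  exact key hg

/-- A nonnegative vector satisfying the clique inequalities given by a perfect elimination order
is a convex combination of indicator vectors of independent sets. -/
theorem mem_independentSetHull_of_rank {D : Type*} [Fintype D] [DecidableEq D] {r : D → D → Prop}
    (hr : Std.Symm r) (rank : D → ℕ) {f : D → ℝ} (hf : ∀ d, 0 ≤ f d)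
    (hK : ∀ d, ∃ K : Finset D, (∀ a ∈ K, ∀ b ∈ K, a ≠ b → r a b) ∧
      (∀ x, x ≠ d → r x d → rank x ≤ rank d → x ∈ K) ∧ f d + ∑ k ∈ K, f k ≤ 1) :
    f ∈ independentSetHull r Set.univ := by
  suffices H : ∀ s : Finset D, (s : Set D).indicator f ∈ independentSetHull r (s : Set D) by
    simpa using H Finset.univ
  intro s
  refine Finset.induction_on_max_value rank s ?_ ?_
  · exact subset_convexHull ℝ _ ⟨∅, by simp, by simp, by simp⟩
  · intro d s hd hmax ih
    obtain ⟨K, hKr, hKN, hKf⟩ := hK d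
    set g := (s : Set D).indicator f with hgdef
    have hgf : ∑ k ∈ K, g k ≤ ∑ k ∈ K, f k :=
      Finset.sum_le_sum fun k _ => Set.indicator_le_self' (fun _ _ => hf _) k
    have h1 := add_slack_mem_independentSetHull hr (S := (s : Set D)) (d := d) (by simpa using hd)
      hKr (fun x hx hxd => hKN x (by rintro rfl; exact hd hx) hxd (hmax x hx)) ih
    have h0 := independentSetHull_mono r (Set.subset_insert d (s : Set D)) ih
    set q := 1 - ∑ k ∈ K, g k with hq
    have hfq : f d ≤ q := by linarith
    have heq : ((insert d s : Finset D) : Set D).indicator f = g + f d • Pi.single d (1 : ℝ) := by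
      ext i
      by_cases hi : i = d
      · subst hi
        simp [hgdef, hd]
      · simp [hgdef, Set.indicator, hi]
    -- If `q = 0` then `f d = 0`, so Lean's division by zero is harmless.
    have hq0 : f d / q * q = f d := by
      rcases eq_or_ne q 0 with h | h
      · have := hf d
        rw [h, mul_zero]
        linarith
      · exact div_mul_cancel₀ _ h
    -- The target lies on the segment from `g` to its raised copy, at parameter `f d / q`.
    have h2 := (convex_convexHull ℝ _).add_smul_mem h0 h1
      (t := f d / q) ⟨div_nonneg (hf d) ((hf d).trans hfq), div_le_one_of_le₀ hfq ((hf d).trans hfq)⟩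
    rw [smul_smul, hq0] at h2
    rw [heq, Finset.coe_insert]
    exact h2

namespace SimpleGraph

/-- In a tree, a vertex has at most one neighbour that is not farther from a given root. -/
theorem IsTree.eq_of_adj_of_dist_le {V : Type*} {G : SimpleGraph V} (hG : G.IsTree) (r : V)
    {v a b : V} (ha : G.Adj v a) (hb : G.Adj v b) (hda : G.dist r a ≤ G.dist r v)
    (hdb : G.dist r b ≤ G.dist r v) : a = b := by
  classical
  -- Adjacent vertices of a tree differ in distance by one, so a shortest path to `c` extends to a
  -- path to `v`; paths in a tree are unique.
  have key : ∀ c, G.Adj v c → G.dist r c ≤ G.dist r v →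
      ∃ p : G.Walk r v, p.IsPath ∧ p.penultimate = c := by
    intro c hc hdc
    obtain ⟨p, hp, hpl⟩ := hG.connected.exists_path_of_dist r c
    refine ⟨p.concat hc.symm, ?_, by simp⟩
    refine Walk.isPath_of_length_eq_dist _ ?_
    have := hG.dist_eq_dist_add_one_of_adj r hc
    rw [Walk.length_concat]
    omega
  obtain ⟨p, hp, hpa⟩ := key a ha hda
  obtain ⟨q, hq, hqb⟩ := key b hb hdb
  rw [← hpa, ← hqb, (hG.existsUnique_path r v).unique hp hq]

end SimpleGraph

namespace TotalMatching

theorem eltAdj_symm {V : Type*} (G : SimpleGraph V) : Std.Symm (EltAdj G) := by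
  refine ⟨?_⟩
  rintro (v | e) (w | f) h
  · exact G.adj_symm h
  · exact h
  · exact h
  · exact ⟨h.1.symm, h.2.imp fun _ h => h.symm⟩

theorem totalMatchingPolytope_eq {V : Type*} (G : SimpleGraph V) :
    totalMatchingPolytope G = independentSetHull (EltAdj G) Set.univ := by
  simp [totalMatchingPolytope, independentSetHull, IsTotalMatching, charVec]

/-- The vector of a total matching sums to at most one over any clique. -/
theorem sum_le_one_of_clique {V : Type*} (G : SimpleGraph V) {K : Finset (Elt G)}
    (hK : ∀ a ∈ K, ∀ b ∈ K, a ≠ b → EltAdj G a b) {z : Elt G → ℝ}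
    (hz : z ∈ totalMatchingPolytope G) : ∑ k ∈ K, z k ≤ 1 := by
  classical
  have key : totalMatchingPolytope G ⊆
      {z | (∑ k ∈ K, LinearMap.proj (R := ℝ) (φ := fun _ => ℝ) k) z ≤ 1} := by
    refine convexHull_min ?_ (convex_halfSpace_le (LinearMap.isLinear _) 1)
    rintro _ ⟨T, hT, rfl⟩
    simp only [Set.mem_ofPred_eq, LinearMap.sum_apply, LinearMap.proj_apply, charVec]
    by_cases hTK : ∃ k ∈ K, k ∈ T
    · obtain ⟨k, hk, hkT⟩ := hTK
      rw [Finset.sum_eq_single_of_mem k hk, Set.indicator_of_mem hkT]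
      intro b hb hbk
      exact Set.indicator_of_notMem (fun hbT => hT hbT hkT hbk (hK b hb k hk hbk)) _
    · push Not at hTK
      rw [Finset.sum_eq_zero fun k hk => Set.indicator_of_notMem (hTK k hk) _]
      exact zero_le_one
  simpa using key hz

theorem nonneg_of_mem {V : Type*} (G : SimpleGraph V) {z : Elt G → ℝ}
    (hz : z ∈ totalMatchingPolytope G) (d : Elt G) : 0 ≤ z d := by
  have key : totalMatchingPolytope G ⊆ {z | 0 ≤ LinearMap.proj (R := ℝ) (φ := fun _ => ℝ) d z} := by
    refine convexHull_min ?_ (convex_halfSpace_ge (LinearMap.isLinear _) 0)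
    rintro _ ⟨T, hT, rfl⟩
    exact Set.indicator_nonneg (fun _ _ => zero_le_one (α := ℝ)) _
  exact key hz

/-- The clique consisting of a vertex and the edges incident to it. -/
def star {V : Type*} [DecidableEq V] (G : SimpleGraph V) [Fintype G.edgeSet] (v : V) :
    Finset (Elt G) :=
  Finset.disjSum {v} (Finset.univ.filter fun e : G.edgeSet => v ∈ (e : Sym2 V))

theorem star_clique {V : Type*} [DecidableEq V] (G : SimpleGraph V) [Fintype G.edgeSet] (v : V) :
    ∀ a ∈ star G v, ∀ b ∈ star G v, a ≠ b → EltAdj G a b := by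
  rintro (a | e) ha (b | f) hb hab <;> simp only [star, Finset.inl_mem_disjSum,
    Finset.inr_mem_disjSum, Finset.mem_singleton, Finset.mem_filter, Finset.mem_univ,
    true_and] at ha hb
  · simp [ha, hb] at hab
  · rw [ha]; exact hb
  · rw [hb]; exact ha
  · exact ⟨fun h => hab (by rw [h]), v, ha, hb⟩

theorem sum_star {V : Type*} [DecidableEq V] (G : SimpleGraph V) [Fintype G.edgeSet] (v : V)
    (z : Elt G → ℝ) : ∑ k ∈ star G v, z k = z (Sum.inl v) +
      ∑ e ∈ Finset.univ.filter (fun e : G.edgeSet => v ∈ (e : Sym2 V)), z (Sum.inr e) := by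
  simp [star, Finset.sum_disjSum]

/-- The clique consisting of an edge and its end vertices. -/
def triangle {V : Type*} [DecidableEq V] (G : SimpleGraph V) {v w : V} (h : G.Adj v w) :
    Finset (Elt G) :=
  Finset.disjSum {v, w} {⟨s(v, w), G.mem_edgeSet.2 h⟩}

theorem triangle_clique {V : Type*} [DecidableEq V] (G : SimpleGraph V) {v w : V}
    (h : G.Adj v w) : ∀ a ∈ triangle G h, ∀ b ∈ triangle G h, a ≠ b → EltAdj G a b := by
  rintro (a | e) ha (b | f) hb hab <;> simp only [triangle, Finset.inl_mem_disjSum,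
    Finset.inr_mem_disjSum, Finset.mem_singleton, Finset.mem_insert] at ha hb
  · rcases ha with rfl | rfl <;> rcases hb with rfl | rfl
    · exact absurd rfl hab
    · exact h
    · exact h.symm
    · exact absurd rfl hab
  · subst hb
    simpa [EltAdj] using ha
  · subst ha
    simpa [EltAdj] using hb
  · exact absurd (by rw [ha, hb]) hab

theorem sum_triangle {V : Type*} [DecidableEq V] (G : SimpleGraph V) {v w : V}
    (h : G.Adj v w) (z : Elt G → ℝ) : ∑ k ∈ triangle G h, z k =
      z (Sum.inl v) + z (Sum.inl w) + z (Sum.inr ⟨s(v, w), G.mem_edgeSet.2 h⟩) := by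
  simp [triangle, Finset.sum_disjSum, Finset.sum_pair h.ne]

/-- The distance from the root `r`, doubled, of a vertex; of an edge, the sum of the distances of
its end vertices. Neighbouring levels alternate between vertices and edges. -/
noncomputable def rootRank {V : Type*} (G : SimpleGraph V) (r : V) : Elt G → ℕ
  | Sum.inl v => 2 * G.dist r v
  | Sum.inr e => Sym2.lift ⟨fun v w => G.dist r v + G.dist r w, fun _ _ => add_comm _ _⟩
      (e : Sym2 V)

/-- Only the root has no earlier neighbour. Any other vertex is preceded by its parent and the edge
between them. An edge is preceded by its upper end and edges there; sibling edges tie in rank,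
whence `≤`. -/
theorem exists_clique_of_rootRank {V : Type*} [DecidableEq V] {G : SimpleGraph V}
    [Fintype G.edgeSet] (hG : G.IsTree) (r : V) (d : Elt G) :
    (∀ x, x ≠ d → EltAdj G x d → ¬ rootRank G r x ≤ rootRank G r d) ∨
      (∃ (v w : V) (h : G.Adj v w), d ∈ triangle G h ∧
        ∀ x, EltAdj G x d → rootRank G r x ≤ rootRank G r d → x ∈ triangle G h) ∨
      ∃ v, d ∈ star G v ∧
        ∀ x, EltAdj G x d → rootRank G r x ≤ rootRank G r d → x ∈ star G v := by
  rcases d with v | ⟨e, he⟩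
  · by_cases hp : ∃ p, G.Adj v p ∧ G.dist r p ≤ G.dist r v
    · obtain ⟨p, hvp, hdp⟩ := hp
      refine Or.inr (Or.inl ⟨v, p, hvp, by simp [triangle], ?_⟩)
      rintro (x | ⟨e, he⟩) hx hrank
      · have : x = p := hG.eq_of_adj_of_dist_le r (G.adj_symm hx) hvp
          (by simpa [rootRank] using hrank) hdp
        simp [triangle, this]
      · obtain ⟨w, rfl⟩ := Sym2.mem_iff_exists.1 (show v ∈ e from hx)
        have hw : G.dist r w ≤ G.dist r v := by
          simp only [rootRank, Sym2.lift_mk] at hrank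
          omega
        have : w = p := hG.eq_of_adj_of_dist_le r he hvp hw hdp
        simp [triangle, this]
    · push Not at hp
      left
      rintro (x | ⟨e, he⟩) - hx hrank
      · have := hp x (G.adj_symm hx)
        simp only [rootRank] at hrank
        omega
      · obtain ⟨w, rfl⟩ := Sym2.mem_iff_exists.1 (show v ∈ e from hx)
        have := hp w he
        simp only [rootRank, Sym2.lift_mk] at hrank
        omega
  · right; right
    obtain ⟨p, c, rfl, hpc⟩ : ∃ p c, e = s(p, c) ∧ G.dist r p ≤ G.dist r c := by
      induction e using Sym2.ind with
      | _ a b =>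
        rcases le_total (G.dist r a) (G.dist r b) with h | h
        · exact ⟨a, b, rfl, h⟩
        · exact ⟨b, a, Sym2.eq_swap, h⟩
    have hadj : G.Adj p c := he
    have hne := hG.dist_ne_of_adj r hadj
    refine ⟨p, by simp [star], ?_⟩
    rintro (x | ⟨f, hf⟩) hx hrank
    · rcases Sym2.mem_iff.1 (show x ∈ s(p, c) from hx) with rfl | rfl
      · simp [star]
      · simp only [rootRank, Sym2.lift_mk] at hrank
        omega
    · obtain ⟨hfe, u, huf, hue⟩ := hx
      rcases Sym2.mem_iff.1 (show u ∈ s(p, c) from hue) with rfl | rfl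
      · simpa [star] using huf
      -- At the lower end `u`, the bound on the rank forces the other end of `f` to be the parent
      -- `p`.
      · obtain ⟨w, rfl⟩ := Sym2.mem_iff_exists.1 (show u ∈ f from huf)
        have hw : G.dist r w ≤ G.dist r u := by
          simp only [rootRank, Sym2.lift_mk] at hrank
          omega
        have : w = p := hG.eq_of_adj_of_dist_le r hf hadj.symm hw hpc
        simp [star, this]

end TotalMatching

/-- For a vector `z = (x, y)`, the coordinate `x_v` is `z (Sum.inl v)` and the coordinate `y_e`
is `z (Sum.inr e)`. -/
theorem mainTheorem1 {V : Type*} [Fintype V] [DecidableEq V] (G : SimpleGraph V)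
    [DecidableRel G.Adj] (hG : G.IsTree) :
    TotalMatching.totalMatchingPolytope G =
      {z : V ⊕ G.edgeSet → ℝ |
        (∀ v : V, z (Sum.inl v) +
          ∑ e ∈ Finset.univ.filter (fun e : G.edgeSet => v ∈ (e : Sym2 V)), z (Sum.inr e) ≤ 1) ∧
        (∀ (v w : V) (h : G.Adj v w),
          z (Sum.inl v) + z (Sum.inl w) +
            z (Sum.inr ⟨s(v, w), (G.mem_edgeSet).2 h⟩) ≤ 1) ∧
        (∀ v : V, 0 ≤ z (Sum.inl v)) ∧
        (∀ e : G.edgeSet, 0 ≤ z (Sum.inr e))} := by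
  classical
  open TotalMatching in
  ext z
  constructor
  · intro hz
    refine ⟨fun v => ?_, fun v w h => ?_, fun v => nonneg_of_mem G hz _,
      fun e => nonneg_of_mem G hz _⟩
    · rw [← sum_star]
      exact sum_le_one_of_clique G (star_clique G v) hz
    · rw [← sum_triangle]
      exact sum_le_one_of_clique G (triangle_clique G h) hz
  · rintro ⟨hstar, htri, hv, he⟩
    have hz0 : ∀ d, 0 ≤ z d := Sum.rec hv he
    -- Serves the case of no earlier neighbour, where the clique is empty.
    have hle : ∀ d, z d ≤ 1 := by
      rintro (v | ⟨e, he'⟩)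
      · exact (le_add_of_nonneg_right (Finset.sum_nonneg fun e _ => he e)).trans (hstar v)
      · induction e using Sym2.ind with
        | _ a b => linarith [htri a b he', hv a, hv b]
    obtain ⟨r⟩ := hG.connected.nonempty
    rw [totalMatchingPolytope_eq]
    refine mem_independentSetHull_of_rank (eltAdj_symm G) (rootRank G r) hz0 fun d => ?_
    have herase : ∀ K : Finset (Elt G), (∀ a ∈ K, ∀ b ∈ K, a ≠ b → EltAdj G a b) →
        d ∈ K → (∀ x, EltAdj G x d → rootRank G r x ≤ rootRank G r d → x ∈ K) →
        ∑ k ∈ K, z k ≤ 1 → ∃ K : Finset (Elt G), (∀ a ∈ K, ∀ b ∈ K, a ≠ b → EltAdj G a b) ∧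
          (∀ x, x ≠ d → EltAdj G x d → rootRank G r x ≤ rootRank G r d → x ∈ K) ∧
          z d + ∑ k ∈ K, z k ≤ 1 := by
      intro K hK hd hN hsum
      refine ⟨K.erase d, fun a ha b hb => hK a (Finset.mem_of_mem_erase ha) b
        (Finset.mem_of_mem_erase hb), fun x hxd hx hrank =>
        Finset.mem_erase.2 ⟨hxd, hN x hx hrank⟩, ?_⟩
      rwa [Finset.add_sum_erase _ _ hd]
    rcases exists_clique_of_rootRank hG r d with h | ⟨v, w, h, hd, hN⟩ | ⟨v, hd, hN⟩
    · exact ⟨∅, by simp, fun x hxd hx hrank => absurd hrank (h x hxd hx), by simpa using hle d⟩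
    · exact herase _ (triangle_clique G h) hd hN (by rw [sum_triangle]; exact htri v w h)
    · exact herase _ (star_clique G v) hd hN (by rw [sum_star]; exact hstar v)
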